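/- Signatures are finite and relational, and all relation symbols have positive arity; structures may be empty. For a structure $\mathfrak C$ with signature $\tau$, $\mathrm{CSP}(\mathfrak C)$ is the class of all finite $\tau$-structures that admit a homomorphism to $\mathfrak C$. A structure $\mathfrak B$ is *binary* if all its relation symbols are binary; it is *homogeneous* if every isomorphism between finite substructures of $\mathfrak B$ extends to an automorphism of $\mathfrak B$; it is *finitely bounded* if there is a finite set $\mathcal F$ of finite structures such that a finite structure embeds into $\mathfrak B$ if and only if no member of $\mathcal F$ embeds into it. A *first-order reduct* of $\mathfrak B$ is a structure on the same domain all of whose relations are first-order definable in $\mathfrak B$ without parameters. An *amalgamation class* is a non-empty class of finite structures that is closed under isomorphism and induced substructures and has the amalgamation property. An *Amalgamation SNP (ASNP) $\tau$-sentence* is a sentence $\Phi=\exists R_1,\dots,R_k\,\forall x_1,\dots,x_n\colon\phi$ such that (i) $R_1,\dots,R_k$ are binary relation symbols; (ii) $\phi$ is quantifier-free without equality, and is a conjunction of $\{R_1,\dots,R_k\}$-formulas and of conjuncts $S(y_1,\dots,y_m)\Rightarrow\psi(y_1,\dots,y_m)$, where $S\in\tau$, $y_1,\dots,y_m$ are distinct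 variables from $x_1,\dots,x_n$, and $\psi$ is an $\{R_1,\dots,R_k\}$-formula; (iii) the class of $\{R_1,\dots,R_k\}$-reducts of the finite models of $\forall x_1,\dots,x_n\colon\phi$ is an amalgamation class. A class of finite $\tau$-structures is *in ASNP* if it is the class of all finite models of some ASNP $\tau$-sentence. **Claim.** (1) For every signature $\tau$, a class of finite $\tau$-structures is in ASNP if and only if it equals $\mathrm{CSP}(\mathfrak C)$ for some first-order reduct $\mathfrak C$, with signature $\tau$, of a binary finitely bounded homogeneous structure. (2) ASNP has a complexity dichotomy if and only if the infinite-domain dichotomy conjecture holds for first-order reducts of binary finitely bounded homogeneous structures; that is, the following are equivalent: (a) every problem in ASNP is in P or NP-complete; (b) for every first-order reduct $\mathfrak C$ of a binary finitely bounded homogeneous structure, $\mathrm{CSP}(\mathfrak C)$ is in P or NP-complete. Here finite structures are encoded as binary words in the standard way (size in unary, followed by the truth tables of the relations), and NP-completeness is with respect to polynomial-time many-one reductions. -/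

import Mathlib

open FirstOrder CategoryTheory

universe u

namespace ASNP

/-! ### Signatures and structures

A signature is a Mathlib first-order language, a structure is a Mathlib structure; homomorphisms,
embeddings, homogeneity, definability, heredity and amalgamation are those of Mathlib. Structures
with empty domain are allowed. -/

/-- A finite relational signature all of whose symbols have positive arity. -/
class IsSignature (L : FirstOrder.Language.{0, 0}) : Prop where
  relational : L.IsRelational
  finite : Finite (Σ k, L.Relations k)
  arity_pos : ∀ (k : ℕ), L.Relations k → 0 < k

/-- All relation symbols are binary. -/
def IsBinary (L : FirstOrder.Language.{0, 0}) : Prop :=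
  ∀ (k : ℕ), L.Relations k → k = 2

/-- A class of (finite) `L`-structures. -/
abbrev StrClass (L : FirstOrder.Language.{0, 0}) : Type 1 :=
  Set (Bundled.{0} L.Structure)

/-- `Csp(C)`: the finite structures that map homomorphically to `C`. -/
def Csp (L : FirstOrder.Language.{0, 0}) (C : Type*) [L.Structure C] : StrClass L :=
  {A | Finite A ∧ Nonempty (A →[L] C)}

/-- A structure is finitely bounded if there is a finite set `F` of finite structures such that a
finite structure belongs to the age (that is, embeds into `B`) if and only if it embeds no member
of `F`. -/
def FinitelyBounded (L : FirstOrder.Language.{0, 0}) (B : Type*) [L.Structure B] : Prop :=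
  ∃ F : StrClass L, F.Finite ∧ (∀ N ∈ F, Finite N) ∧
    ∀ A : Bundled.{0} L.Structure, Finite A →
      (Nonempty (A ↪[L] B) ↔ ∀ N ∈ F, IsEmpty (N ↪[L] A))

/-- The `τ`-structure on `B` is a first-order reduct of the `σ`-structure on `B`: every relation of
the former is first-order definable, without parameters, in the latter. -/
def IsFirstOrderReduct (τ σ : FirstOrder.Language.{0, 0}) (B : Type*) [τ.Structure B] [σ.Structure B] :
    Prop :=
  ∀ (k : ℕ) (S : τ.Relations k),
    (∅ : Set B).Definable σ {x : Fin k → B | FirstOrder.Language.Structure.RelMap S x}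

/-- An amalgamation class: a (nonempty) class of finite structures that is closed under
isomorphism and induced substructures and has the amalgamation property. -/
structure IsAmalgamationClass {L : FirstOrder.Language.{0, 0}} (K : StrClass L) : Prop where
  nonempty : K.Nonempty
  finite : ∀ M ∈ K, Finite M
  hereditary : FirstOrder.Language.Hereditary K
  amalgamation : FirstOrder.Language.Amalgamation K

/-! ### SNP and Amalgamation SNP -/

/-- The equality symbol does not occur in the formula. -/
def EqFree {L : FirstOrder.Language.{0, 0}} {α : Type} : {m : ℕ} → L.BoundedFormula α m → Prop
  | _, .falsum => True
  | _, .equal _ _ => False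
  | _, .rel _ _ => True
  | _, .imp φ ψ => EqFree φ ∧ EqFree ψ
  | _, .all φ => EqFree φ

/-- An SNP `τ`-sentence `∃ R₁,…,Rₖ ∀ x₁,…,xₙ : φ`, where `ρ` is the signature `{R₁,…,Rₖ}` and `φ` is
a quantifier-free formula over `τ ∪ ρ` without equality. -/
structure SNPSentence (τ : FirstOrder.Language.{0, 0}) where
  ρ : FirstOrder.Language.{0, 0}
  isSignature : IsSignature ρ
  n : ℕ
  φ : (τ.sum ρ).Formula (Fin n)
  isQF : φ.IsQF
  eqFree : EqFree φ

/-- `M ⊨ ∀ x₁,…,xₙ : φ`, for a `τ`-structure and a `ρ`-structure on the same domain `M`. -/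
def SNPSentence.FirstOrderPart {τ : FirstOrder.Language.{0, 0}} (Φ : SNPSentence τ) (M : Type)
    [τ.Structure M] [Φ.ρ.Structure M] : Prop :=
  ∀ v : Fin Φ.n → M, Φ.φ.Realize v

/-- `⟦Φ⟧`: the finite models of `Φ`. -/
def SNPSentence.models {τ : FirstOrder.Language.{0, 0}} (Φ : SNPSentence τ) : StrClass τ :=
  {A | Finite A ∧ ∃ _ : Φ.ρ.Structure A, Φ.FirstOrderPart A}

/-- The `ρ`-reducts of the finite models of the first-order part of `Φ`. -/
def SNPSentence.reducts {τ : FirstOrder.Language.{0, 0}} (Φ : SNPSentence τ) : StrClass Φ.ρ :=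
  {M | Finite M ∧ ∃ _ : τ.Structure M, Φ.FirstOrderPart M}

/-- Conjunctions of `ρ`-formulas and of conjuncts `S(x₁,…,xₖ) ⇒ ψ(x₁,…,xₖ)`, where `S ∈ τ`, the
variables `x₁,…,xₖ` are distinct, and `ψ` is a `ρ`-formula; all formulas are quantifier-free and
without equality. -/
inductive IsASNPConjunction {τ ρ : FirstOrder.Language.{0, 0}} {n : ℕ} :
    (τ.sum ρ).Formula (Fin n) → Prop
  | existential (χ : ρ.Formula (Fin n)) (hqf : χ.IsQF) (heq : EqFree χ) :
      IsASNPConjunction (FirstOrder.Language.LHom.sumInr.onFormula χ)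
  | implication {k : ℕ} (S : τ.Relations k) (x : Fin k ↪ Fin n) (ψ : ρ.Formula (Fin k))
      (hqf : ψ.IsQF) (heq : EqFree ψ) :
      IsASNPConjunction
        ((FirstOrder.Language.Relations.formula (L := τ.sum ρ) (Sum.inl S)
            (fun i => FirstOrder.Language.Term.var (x i))).imp
          (FirstOrder.Language.LHom.sumInr.onFormula (ψ.relabel x)))
  | and {φ₁ φ₂ : (τ.sum ρ).Formula (Fin n)} :
      IsASNPConjunction φ₁ → IsASNPConjunction φ₂ → IsASNPConjunction (φ₁ ⊓ φ₂)

/-- Amalgamation SNP sentences. -/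
structure SNPSentence.IsASNP {τ : FirstOrder.Language.{0, 0}} (Φ : SNPSentence τ) : Prop where
  binary : IsBinary Φ.ρ
  conjunction : IsASNPConjunction Φ.φ
  amalgamation : IsAmalgamationClass Φ.reducts

/-- The class `K` of finite `τ`-structures is in ASNP. -/
def InASNP {τ : FirstOrder.Language.{0, 0}} (K : StrClass τ) : Prop :=
  ∃ Φ : SNPSentence τ, Φ.IsASNP ∧ Φ.models = K

/-- `K` is `Csp(C)` for a first-order reduct `C` of a binary finitely bounded homogeneous
structure (of arbitrary cardinality). -/
def IsBinaryReductCsp {τ : FirstOrder.Language.{0, 0}} (K : StrClass τ) : Prop :=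
  ∃ (σ : FirstOrder.Language.{0, 0}) (B : Type u) (_ : σ.Structure B) (_ : τ.Structure B),
    IsSignature σ ∧ IsBinary σ ∧ FinitelyBounded σ B ∧ σ.IsUltrahomogeneous B ∧
      IsFirstOrderReduct τ σ B ∧ Csp τ B = K

/-! ### Complexity -/

/-- The property `p` of inputs encoded by `e` is decidable in polynomial time on a (multi-stack)
Turing machine. -/
def PolyTimeDecidable {α Γ : Type} (e : α → List Γ) (p : α → Prop) : Prop :=
  open Classical in
  Nonempty (Turing.TM2ComputableInPolyTime e Computability.encodeBool (fun a => decide (p a)))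

/-- The complexity class P. -/
def InP (X : Set (List Bool)) : Prop :=
  PolyTimeDecidable (fun w : List Bool => w) (fun w => w ∈ X)

/-- The encoding `w#c` of a pair of binary words, over the alphabet `{0, 1, #}`. -/
def encodePair (p : List Bool × List Bool) : List (Option Bool) :=
  p.1.map some ++ none :: p.2.map some

/-- The complexity class NP: polynomial-time verifiable certificates of polynomial length. -/
def InNP (X : Set (List Bool)) : Prop :=
  ∃ (V : List Bool × List Bool → Prop) (q : Polynomial ℕ), PolyTimeDecidable encodePair V ∧
    ∀ w : List Bool, w ∈ X ↔ ∃ c : List Bool, c.length ≤ q.eval w.length ∧ V (w, c)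

/-- Polynomial-time many-one reducibility. -/
def PolyTimeReducible (X Y : Set (List Bool)) : Prop :=
  ∃ f : List Bool → List Bool,
    Nonempty (Turing.TM2ComputableInPolyTime (fun w : List Bool => w) (fun w : List Bool => w) f) ∧
      ∀ w, w ∈ X ↔ f w ∈ Y

/-- NP-completeness. -/
def NPComplete (X : Set (List Bool)) : Prop :=
  InNP X ∧ ∀ Y : Set (List Bool), InNP Y → PolyTimeReducible Y X

/-- The truth table of a `k`-ary relation on `{0,…,m-1}`: one bit for each of the `m ^ k` tuples. -/
noncomputable def truthTable {m k : ℕ} (R : (Fin k → Fin m) → Prop) : List Bool :=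
  open Classical in
  List.ofFn fun i : Fin (m ^ k) => decide (R (finFunctionFinEquiv.symm i))

/-- The encoding of a `τ`-structure with domain `{0,…,m-1}` as a binary word: the size `m` in unary,
the separator `0`, and the truth tables of all relations, in a fixed order of the symbols of `τ`. -/
noncomputable def encodeStructure (τ : FirstOrder.Language.{0, 0}) [IsSignature τ] (m : ℕ)
    (A : τ.Structure (Fin m)) : List Bool :=
  haveI : Finite (Σ k, τ.Relations k) := IsSignature.finite
  List.replicate m true ++ false ::
    (List.ofFn fun i : Fin (Nat.card (Σ k, τ.Relations k)) =>
      truthTable (A.RelMap ((Finite.equivFin (Σ k, τ.Relations k)).symm i).2)).flatten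

/-- The decision problem of a class `K` of finite structures: the set of all encodings of members
of `K`. -/
def problem {τ : FirstOrder.Language.{0, 0}} [IsSignature τ] (K : StrClass τ) : Set (List Bool) :=
  {w | ∃ (m : ℕ) (A : τ.Structure (Fin m)), Bundled.mk (Fin m) A ∈ K ∧ encodeStructure τ m A = w}

/-- Every problem in ASNP is in P or NP-complete. -/
def ASNPDichotomy : Prop :=
  ∀ (τ : FirstOrder.Language.{0, 0}) [IsSignature τ] (K : StrClass τ), InASNP K →
    InP (problem K) ∨ NPComplete (problem K)

/-- The infinite-domain dichotomy conjecture for first-order reducts of binary finitely bounded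
homogeneous structures: their CSPs are in P or NP-complete. -/
def BinaryInfiniteDomainDichotomy : Prop :=
  ∀ (τ : FirstOrder.Language.{0, 0}) [IsSignature τ] (σ : FirstOrder.Language.{0, 0}) [IsSignature σ]
    (B : Type u) [σ.Structure B] [τ.Structure B],
    IsBinary σ → FinitelyBounded σ B → σ.IsUltrahomogeneous B → IsFirstOrderReduct τ σ B →
      InP (problem (Csp τ B)) ∨ NPComplete (problem (Csp τ B))

end ASNP

/-!
The complexity statement follows from the equality of the two families of classes, so the content
is the latter.

Throughout, the point is that a quantifier-free formula without equality only depends on the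
equality-free atomic formulas satisfied by a tuple (`SameAtoms`). Such formulas are therefore
preserved and reflected by strong homomorphisms, injective or not, and structures may be pulled back
along arbitrary maps without affecting them.

*From a template to a sentence* (`inASNP_csp`). Let `B` be a binary finitely bounded homogeneous
structure, and expand it by a binary symbol for equality. The finite structures with a strong
homomorphism to this expansion are the blow-ups of the finite substructures of `B`. By finite
boundedness they can be recognized from their tuples of bounded length
(`exists_sameAtoms_of_forall_tuple`), hence by a universal sentence without equality
(`exists_formula_sameAtoms`), and by homogeneity they form an amalgamation class
(`isAmalgamationClass_blowUps`). Also by homogeneity, the atomic type of a tuple determines its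
orbit (`exists_equiv_of_sameAtoms`), hence the relations of the reduct that it satisfies. So an ASNP
sentence can guess a map to `B`, up to automorphisms, and verify that it is a homomorphism.

*From a sentence to a template* (`IsBinaryReductCsp.of_inASNP`). An ASNP sentence is brought into
the form of a universal `ρ`-sentence together with an upper bound, defined over `ρ`, for each
relation of `τ` (`IsASNPConjunction.exists_normalForm`). The `ρ`-reducts of its models are an
amalgamation class; its Fraïssé limit `B` is built as the union of a chain of finite structures
that successively solve all extension problems (`IsAmalgamationClass.exists_isUltrahomogeneous`).
It is finitely bounded because its age is defined by a universal sentence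
(`finitelyBounded_of_age`). The template is `B` with the upper bounds as its `τ`-relations.
-/

namespace ASNP

open FirstOrder.Language FirstOrder.Language.Structure

universe v w

/-! ### Equality-free quantifier-free formulas -/

/-- Two tuples, possibly in different structures, satisfy the same equality-free atomic formulas
of a relational language. For `v = id` this says that `w` is a strong homomorphism (it preserves
and reflects all relations, but need not be injective). -/
def SameAtoms (L : FirstOrder.Language.{0, 0}) {X : Type*} {M : Type v} {N : Type w}
    [L.Structure M] [L.Structure N] (v : X → M) (w : X → N) : Prop :=
  ∀ (k : ℕ) (R : L.Relations k) (x : Fin k → X), RelMap R (v ∘ x) ↔ RelMap R (w ∘ x)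

section SameAtoms

variable {L : FirstOrder.Language.{0, 0}} {M : Type v} {N : Type w} [L.Structure M] [L.Structure N]

theorem SameAtoms.symm {X : Type*} {v : X → M} {w : X → N} (h : SameAtoms L v w) :
    SameAtoms L w v := fun k R x => (h k R x).symm

theorem SameAtoms.trans {X P : Type*} [L.Structure P] {v : X → M} {w : X → N} {u : X → P}
    (h : SameAtoms L v w) (h' : SameAtoms L w u) : SameAtoms L v u :=
  fun k R x => (h k R x).trans (h' k R x)

theorem SameAtoms.comp {X Y : Type*} {v : X → M} {w : X → N} (h : SameAtoms L v w) (f : Y → X) :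
    SameAtoms L (v ∘ f) (w ∘ f) := fun k R x => h k R (f ∘ x)

theorem SameAtoms.of_embedding (f : M ↪[L] N) : SameAtoms L (id : M → M) f :=
  fun _ R x => (f.map_rel R x).symm

theorem SameAtoms.realize_boundedFormula [L.IsRelational] {α : Type} {m : ℕ}
    {φ : L.BoundedFormula α m} (hqf : φ.IsQF) (heq : EqFree φ) {v : α → M} {w : α → N}
    {xs : Fin m → M} {ys : Fin m → N} (h : SameAtoms L (Sum.elim v xs) (Sum.elim w ys)) :
    φ.Realize v xs ↔ φ.Realize w ys := by
  induction hqf with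
  | falsum => rfl
  | of_isAtomic hA =>
    cases hA with
    | equal t₁ t₂ => exact heq.elim
    | @rel l R ts =>
      have hts : ∀ i, ∃ y, ts i = Term.var y := fun i => by
        cases ts i with
        | var y => exact ⟨y, rfl⟩
        | func f _ => exact isEmptyElim f
      choose y hy using hts
      obtain rfl : ts = fun i => Term.var (y i) := funext hy
      exact h l R y
  | imp _ _ ih₁ ih₂ =>
    rw [BoundedFormula.realize_imp, BoundedFormula.realize_imp, ih₁ heq.1, ih₂ heq.2]

/-- Without equality, quantifier-free formulas only see the atomic formulas without equality. -/
theorem SameAtoms.realize_formula [L.IsRelational] {α : Type}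
    {φ : L.Formula α} (hqf : φ.IsQF) (heq : EqFree φ) {v : α → M} {w : α → N}
    (h : SameAtoms L v w) : φ.Realize v ↔ φ.Realize w := by
  refine SameAtoms.realize_boundedFormula hqf heq fun k R x => ?_
  have hx : ∀ i, ∃ y, x i = Sum.inl y := fun i => by
    cases x i with
    | inl y => exact ⟨y, rfl⟩
    | inr z => exact z.elim0
  choose y hy using hx
  obtain rfl : x = Sum.inl ∘ y := funext hy
  exact h k R y

end SameAtoms

section Pullback

variable (L : FirstOrder.Language.{0, 0}) [L.IsRelational]

/-- The structure on `X` pulled back along a map `f : X → N`, the coarsest one that makes `f` a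
strong homomorphism. -/
abbrev pullback {X : Type v} {N : Type w} [L.Structure N] (f : X → N) : L.Structure X where
  funMap g := isEmptyElim g
  RelMap R x := RelMap R (f ∘ x)

theorem sameAtoms_pullback {X : Type v} {N : Type w} [L.Structure N] (f : X → N) :
    letI := pullback L f
    SameAtoms L (id : X → X) f := fun _ _ _ => Iff.rfl

/-- The structure all of whose relations are empty. -/
abbrev edgeless (X : Type v) : L.Structure X where
  funMap g := isEmptyElim g
  RelMap _ _ := False

variable {L}

/-- In a relational language, an injective strong homomorphism is an embedding. -/
def SameAtoms.toEmbedding {M : Type v} {N : Type w} [L.Structure M] [L.Structure N] {f : M → N}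
    (h : SameAtoms L (id : M → M) f) (hf : Function.Injective f) : M ↪[L] N where
  toFun := f
  inj' := hf
  map_fun' g := isEmptyElim g
  map_rel' R x := (h _ R x).symm

end Pullback

section Formulas

variable {L L' : FirstOrder.Language.{0, 0}} {α : Type}

theorem eqFree_inf {m : ℕ} {φ ψ : L.BoundedFormula α m} (hφ : EqFree φ) (hψ : EqFree ψ) :
    EqFree (φ ⊓ ψ) := ⟨⟨hφ, hψ, trivial⟩, trivial⟩

theorem isQF_onBoundedFormula (g : L →ᴸ L') {m : ℕ} {φ : L.BoundedFormula α m} (h : φ.IsQF) :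
    (g.onBoundedFormula φ).IsQF := by
  induction h with
  | falsum => exact .falsum
  | of_isAtomic hA =>
    cases hA with
    | equal t₁ t₂ => exact .of_isAtomic (.equal _ _)
    | rel R ts => exact .of_isAtomic (.rel _ _)
  | imp _ _ ih₁ ih₂ => exact ih₁.imp ih₂

theorem eqFree_onBoundedFormula (g : L →ᴸ L') {m : ℕ} {φ : L.BoundedFormula α m}
    (h : EqFree φ) : EqFree (g.onBoundedFormula φ) := by
  induction φ with
  | falsum => trivial
  | equal => exact h.elim
  | rel => trivial
  | imp _ _ ih₁ ih₂ => exact ⟨ih₁ h.1, ih₂ h.2⟩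
  | all _ ih => exact ih h

theorem eqFree_castLE {m n : ℕ} (hmn : m ≤ n) {φ : L.BoundedFormula α m}
    (h : EqFree φ) : EqFree (φ.castLE hmn) := by
  induction φ generalizing n with
  | falsum => trivial
  | equal => exact h.elim
  | rel => trivial
  | imp _ _ ih₁ ih₂ => exact ⟨ih₁ _ h.1, ih₂ _ h.2⟩
  | all _ ih => exact ih _ h

theorem eqFree_relabel {β : Type} {m n : ℕ} (g : α → β ⊕ Fin n) {φ : L.BoundedFormula α m}
    (h : EqFree φ) : EqFree (φ.relabel g) := by
  induction φ with
  | falsum => trivial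
  | equal => exact h.elim
  | rel => trivial
  | imp _ _ ih₁ ih₂ => exact ⟨ih₁ h.1, ih₂ h.2⟩
  | all _ ih => exact eqFree_castLE _ (ih h)

theorem exists_formula_forall {ι : Type*} [Finite ι] (a : ι → L.Formula α)
    (ha : ∀ i, (a i).IsQF ∧ EqFree (a i)) :
    ∃ φ : L.Formula α, φ.IsQF ∧ EqFree φ ∧
      ∀ (M : Type) [L.Structure M] (v : α → M), φ.Realize v ↔ ∀ i, (a i).Realize v := by
  classical
  have := Fintype.ofFinite ι
  suffices h : ∀ s : Finset ι, ∃ φ : L.Formula α, φ.IsQF ∧ EqFree φ ∧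
      ∀ (M : Type) [L.Structure M] (v : α → M), φ.Realize v ↔ ∀ i ∈ s, (a i).Realize v by
    simpa using h Finset.univ
  intro s
  induction s using Finset.induction_on with
  | empty => exact ⟨⊤, .top, ⟨trivial, trivial⟩, fun M _ v => by simp⟩
  | insert i s _ ih =>
    obtain ⟨φ, hqf, heq, hφ⟩ := ih
    exact ⟨a i ⊓ φ, (ha i).1.inf hqf, eqFree_inf (ha i).2 heq, fun M _ v => by
      rw [Formula.realize_inf, hφ, Finset.forall_mem_insert]⟩

theorem exists_formula_exists {ι : Type*} [Finite ι] (a : ι → L.Formula α)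
    (ha : ∀ i, (a i).IsQF ∧ EqFree (a i)) :
    ∃ φ : L.Formula α, φ.IsQF ∧ EqFree φ ∧
      ∀ (M : Type) [L.Structure M] (v : α → M), φ.Realize v ↔ ∃ i, (a i).Realize v := by
  obtain ⟨φ, hqf, heq, hφ⟩ := exists_formula_forall (fun i => (a i).not)
    (fun i => ⟨(ha i).1.not, (ha i).2, trivial⟩)
  exact ⟨φ.not, hqf.not, ⟨heq, trivial⟩, fun M _ v => by
    rw [Formula.realize_not, hφ]; simp⟩

/-- Over a finite relational language, every property of a finite tuple that depends only on the
equality-free atomic formulas that the tuple satisfies is defined by an equality-free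
quantifier-free formula. Here the property is that of satisfying the same atomic formulas as some
tuple `w` with `P w` in a given structure. -/
theorem exists_formula_sameAtoms (hL : Finite (Σ k, L.Relations k)) [Finite α]
    {B : Type u} [L.Structure B] (P : (α → B) → Prop) :
    ∃ φ : L.Formula α, φ.IsQF ∧ EqFree φ ∧
      ∀ (M : Type) [L.Structure M] (v : α → M),
        φ.Realize v ↔ ∃ w : α → B, P w ∧ SameAtoms L v w := by
  classical
  let T := Σ p : (Σ k, L.Relations k), (Fin p.1 → α)
  let a : T → L.Formula α := fun t => t.1.2.formula fun i => Term.var (t.2 i)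
  let pattern : (α → B) → Set T := fun w => {t | RelMap t.1.2 (w ∘ t.2)}
  have ha : ∀ t, (a t).IsQF ∧ EqFree (a t) := fun t => ⟨.of_isAtomic (.rel _ _), trivial⟩
  -- For each of the finitely many realized patterns, the conjunction of literals describing it.
  have hd : ∀ s : Set T, ∃ φ : L.Formula α, φ.IsQF ∧ EqFree φ ∧
      ∀ (M : Type) [L.Structure M] (v : α → M), φ.Realize v ↔
        ∀ t, (if t ∈ s then a t else (a t).not).Realize v := fun s => by
    refine exists_formula_forall (fun t => if t ∈ s then a t else (a t).not) fun t => ?_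
    by_cases h : t ∈ s
    · simpa [h] using ha t
    · simpa [h] using ⟨(ha t).1.not, (ha t).2, trivial⟩
  choose d hdqf hdeq hd using hd
  obtain ⟨φ, hqf, heq, hφ⟩ := exists_formula_exists
    (fun s : {s : Set T // ∃ w, P w ∧ s = pattern w} => d s) fun s => ⟨hdqf s, hdeq s⟩
  refine ⟨φ, hqf, heq, fun M _ v => ?_⟩
  have hat : ∀ t, (a t).Realize v ↔ RelMap t.1.2 (v ∘ t.2) := fun t => by
    simp only [a, Formula.realize_rel, Term.realize_var]; rfl
  have key : ∀ w : α → B, (d (pattern w)).Realize v ↔ SameAtoms L v w := fun w => by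
    rw [hd]
    constructor
    · intro h k R x
      have := h ⟨⟨k, R⟩, x⟩
      by_cases hw : RelMap R (w ∘ x)
      · rw [if_pos (show (⟨⟨k, R⟩, x⟩ : T) ∈ pattern w from hw), hat] at this
        exact iff_of_true this hw
      · rw [if_neg (show (⟨⟨k, R⟩, x⟩ : T) ∉ pattern w from hw), Formula.realize_not, hat] at this
        exact iff_of_false this hw
    · intro h t
      have := h t.1.1 t.1.2 t.2
      by_cases hw : t ∈ pattern w
      · rw [if_pos hw, hat]; exact this.2 hw
      · rw [if_neg hw, Formula.realize_not, hat]; exact fun h' => hw (this.1 h')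
  rw [hφ]
  constructor
  · rintro ⟨⟨_, w, hw, rfl⟩, h⟩
    exact ⟨w, hw, (key w).1 h⟩
  · rintro ⟨w, hw, h⟩
    exact ⟨⟨_, w, hw, rfl⟩, (key w).2 h⟩

end Formulas

/-! ### The normal form of ASNP conjunctions -/

section Conjunctions

variable {τ ρ : FirstOrder.Language.{0, 0}} {n : ℕ}

theorem IsASNPConjunction.isQF_eqFree {φ : (τ.sum ρ).Formula (Fin n)} (h : IsASNPConjunction φ) :
    φ.IsQF ∧ EqFree φ := by
  induction h with
  | existential χ hqf heq => exact ⟨isQF_onBoundedFormula _ hqf, eqFree_onBoundedFormula _ heq⟩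
  | implication S x ψ hqf heq =>
    exact ⟨(BoundedFormula.IsQF.of_isAtomic (.rel _ _)).imp
        (isQF_onBoundedFormula _ (hqf.relabel _)), trivial,
      eqFree_onBoundedFormula _ (eqFree_relabel _ heq)⟩
  | and _ _ ih₁ ih₂ => exact ⟨ih₁.1.inf ih₂.1, eqFree_inf ih₁.2 ih₂.2⟩

theorem realize_implication {k : ℕ} (S : τ.Relations k) (x : Fin k ↪ Fin n)
    (ψ : ρ.Formula (Fin k)) {M : Type} [τ.Structure M] [ρ.Structure M] (v : Fin n → M) :
    Formula.Realize ((FirstOrder.Language.Relations.formula (L := τ.sum ρ) (Sum.inl S)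
            (fun i => FirstOrder.Language.Term.var (x i))).imp
          (FirstOrder.Language.LHom.sumInr.onFormula (ψ.relabel x))) v ↔
      (RelMap S (v ∘ x) → ψ.Realize (v ∘ x)) := by
  rw [Formula.realize_imp, LHom.realize_onFormula, Formula.realize_relabel]
  exact imp_congr_left (Formula.realize_rel (L := τ.sum ρ))

/-- Every `k`-tuple with `0 < k` is the restriction of an `n`-tuple along a given choice of `k`
distinct variables. -/
theorem exists_comp_eq {M : Type*} {k : ℕ} (hk : 0 < k) (x : Fin k ↪ Fin n) (a : Fin k → M) :
    ∃ v : Fin n → M, v ∘ x = a := by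
  have : Nonempty (Fin k) := ⟨⟨0, hk⟩⟩
  exact ⟨a ∘ Function.invFun x, funext fun i => congrArg a (Function.leftInverse_invFun x.2 i)⟩

/-- The universal closure of an ASNP conjunction says that the `ρ`-reduct satisfies a universal
sentence, and that every `τ`-relation is contained in a relation defined over the `ρ`-reduct. -/
theorem IsASNPConjunction.exists_normalForm [IsSignature τ] {φ : (τ.sum ρ).Formula (Fin n)}
    (h : IsASNPConjunction φ) :
    ∃ (χ : ρ.Formula (Fin n)) (ψ : ∀ p : Σ k, τ.Relations k, ρ.Formula (Fin p.1)),
      χ.IsQF ∧ EqFree χ ∧ (∀ p, (ψ p).IsQF ∧ EqFree (ψ p)) ∧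
      ∀ (M : Type) [τ.Structure M] [ρ.Structure M],
        (∀ v : Fin n → M, φ.Realize v) ↔ (∀ v : Fin n → M, χ.Realize v) ∧
          ∀ (p : Σ k, τ.Relations k) (a : Fin p.1 → M), RelMap p.2 a → (ψ p).Realize a := by
  classical
  have htop : ∀ p : Σ k, τ.Relations k, (⊤ : ρ.Formula (Fin p.1)).IsQF ∧
    EqFree (⊤ : ρ.Formula (Fin p.1)) := fun p => ⟨.top, trivial, trivial⟩
  induction h with
  | existential χ hqf heq =>
    refine ⟨χ, fun _ => ⊤, hqf, heq, htop, fun M _ _ => ?_⟩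
    simp [LHom.realize_onFormula]
  | implication S x ψ hqf heq =>
    refine ⟨⊤, Function.update (fun _ => ⊤) ⟨_, S⟩ ψ, .top, ⟨trivial, trivial⟩, fun p => ?_,
      fun M _ _ => ?_⟩
    · by_cases hp : p = ⟨_, S⟩
      · subst hp; simpa using ⟨hqf, heq⟩
      · simpa [hp] using htop p
    · simp only [realize_implication]
      constructor
      · intro h
        refine ⟨by simp, fun p a ha => ?_⟩
        by_cases hp : p = ⟨_, S⟩
        · subst hp
          obtain ⟨v, rfl⟩ := exists_comp_eq (IsSignature.arity_pos _ S) x a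
          simpa using h v ha
        · simp [hp]
      · intro h v hv
        simpa using h.2 ⟨_, S⟩ _ hv
  | and _ _ ih₁ ih₂ =>
    obtain ⟨χ₁, ψ₁, hqf₁, heq₁, hψ₁, h₁⟩ := ih₁
    obtain ⟨χ₂, ψ₂, hqf₂, heq₂, hψ₂, h₂⟩ := ih₂
    refine ⟨χ₁ ⊓ χ₂, fun p => ψ₁ p ⊓ ψ₂ p, hqf₁.inf hqf₂, eqFree_inf heq₁ heq₂,
      fun p => ⟨(hψ₁ p).1.inf (hψ₂ p).1, eqFree_inf (hψ₁ p).2 (hψ₂ p).2⟩, fun M _ _ => ?_⟩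
    simp only [Formula.realize_inf, forall_and, h₁, h₂]
    exact and_and_and_comm

/-- Conversely, such a normal form is expressed by an ASNP conjunction, given enough variables. -/
theorem exists_isASNPConjunction [IsSignature τ] (χ : ρ.Formula (Fin n)) (hqf : χ.IsQF)
    (heq : EqFree χ) (ψ : ∀ p : Σ k, τ.Relations k, ρ.Formula (Fin p.1))
    (hψ : ∀ p, (ψ p).IsQF ∧ EqFree (ψ p)) (hn : ∀ p : Σ k, τ.Relations k, p.1 ≤ n) :
    ∃ φ : (τ.sum ρ).Formula (Fin n), IsASNPConjunction φ ∧
      ∀ (M : Type) [τ.Structure M] [ρ.Structure M],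
        (∀ v : Fin n → M, φ.Realize v) ↔ (∀ v : Fin n → M, χ.Realize v) ∧
          ∀ (p : Σ k, τ.Relations k) (a : Fin p.1 → M), RelMap p.2 a → (ψ p).Realize a := by
  classical
  have : Finite (Σ k, τ.Relations k) := IsSignature.finite
  have := Fintype.ofFinite (Σ k, τ.Relations k)
  suffices h : ∀ s : Finset (Σ k, τ.Relations k), ∃ φ : (τ.sum ρ).Formula (Fin n),
      IsASNPConjunction φ ∧ ∀ (M : Type) [τ.Structure M] [ρ.Structure M],
        (∀ v : Fin n → M, φ.Realize v) ↔ (∀ v : Fin n → M, χ.Realize v) ∧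
          ∀ p ∈ s, ∀ a : Fin p.1 → M, RelMap p.2 a → (ψ p).Realize a by
    simpa using h Finset.univ
  intro s
  induction s using Finset.induction_on with
  | empty =>
    refine ⟨_, .existential χ hqf heq, fun M _ _ => ?_⟩
    simp [LHom.realize_onFormula]
  | insert p s _ ih =>
    obtain ⟨φ, hφ, h⟩ := ih
    refine ⟨_, .and hφ (.implication p.2 (Fin.castLEEmb (hn p)) (ψ p) (hψ p).1 (hψ p).2),
      fun M _ _ => ?_⟩
    simp only [Formula.realize_inf, forall_and, h, realize_implication, Finset.forall_mem_insert]
    rw [and_assoc, and_comm (a := ∀ p ∈ s, _)]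
    refine and_congr_right fun _ => and_congr_left fun _ => ⟨fun h a ha => ?_, fun h v => h _⟩
    obtain ⟨v, rfl⟩ := exists_comp_eq (IsSignature.arity_pos _ p.2) (Fin.castLEEmb (hn p)) a
    exact h v ha

end Conjunctions

/-! ### From reducts of binary finitely bounded homogeneous structures to ASNP -/

/-- The only symbol of the language of equality. -/
inductive EqSymbol : ℕ → Type
  | eq : EqSymbol 2

/-- The language with one binary symbol, to be interpreted as equality. -/
def eqLang : FirstOrder.Language.{0, 0} := ⟨fun _ => Empty, EqSymbol⟩

/-- The interpretation of the symbol of `eqLang` as actual equality. -/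
instance eqStructure (B : Type*) : eqLang.Structure B where
  funMap g := g.elim
  RelMap R x := match R with
    | EqSymbol.eq => x 0 = x 1

/-- The symbol of `eqLang` as a symbol of an expanded signature. -/
def eqSymbol (σ : FirstOrder.Language.{0, 0}) : (σ.sum eqLang).Relations 2 := Sum.inr EqSymbol.eq

instance isSignature_sum_eqLang (σ : FirstOrder.Language.{0, 0}) [IsSignature σ] :
    IsSignature (σ.sum eqLang) where
  relational n := by
    have := IsSignature.relational (L := σ)
    exact ⟨fun f => f.elim isEmptyElim Empty.elim⟩
  finite := by
    have := IsSignature.finite (L := σ)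
    have : Finite (Σ k, EqSymbol k) :=
      Finite.of_injective (β := Unit) (fun _ => ()) (by rintro ⟨_, ⟨⟩⟩ ⟨_, ⟨⟩⟩ _; rfl)
    exact Finite.of_equiv _ (Equiv.sigmaSumDistrib σ.Relations EqSymbol).symm
  arity_pos k R := by
    rcases R with R | R
    · exact IsSignature.arity_pos k R
    · cases R; exact two_pos

theorem isBinary_sum_eqLang {σ : FirstOrder.Language.{0, 0}} (h : IsBinary σ) :
    IsBinary (σ.sum eqLang) := by
  rintro k (R | R)
  · exact h k R
  · cases R; rfl

section

variable {σ : FirstOrder.Language.{0, 0}} {B : Type u} [σ.Structure B]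

/-- In a homogeneous relational structure, tuples of the same quantifier-free type lie in the same
orbit. -/
theorem exists_equiv_of_sameAtoms [σ.IsRelational] (hB : σ.IsUltrahomogeneous B) {X : Type*}
    [Finite X] {b c : X → B} (h : SameAtoms (σ.sum eqLang) b c) :
    ∃ g : B ≃[σ] B, ∀ i, g (b i) = c i := by
  have heq : ∀ i j, b i = b j ↔ c i = c j := fun i j => h 2 (eqSymbol σ) ![i, j]
  have hrel : ∀ k (R : σ.Relations k) (x : Fin k → X), RelMap R (b ∘ x) ↔ RelMap R (c ∘ x) :=
    fun k R x => h k (Sum.inl R) x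
  let S := Substructure.closure σ (Set.range b)
  have hS : ∀ s : S, ∃ i, b i = s := fun s =>
    (Substructure.mem_closure_iff_of_isRelational σ (Set.range b) s).1 s.2
  choose p hp using hS
  let f : S ↪[σ] B :=
    { toFun := fun s => c (p s)
      inj' := fun s t hst => Subtype.ext (by rw [← hp s, ← hp t]; exact (heq _ _).2 hst)
      map_fun' := fun g => isEmptyElim g
      map_rel' := fun R x => by
        have := hrel _ R (fun i => p (x i))
        have hbx : (b ∘ fun i => p (x i)) = fun i => ((x i : S) : B) := funext fun i => hp (x i)
        rw [hbx] at this
        exact this.symm }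
  obtain ⟨g, hg⟩ := hB S (Substructure.fg_closure (Set.finite_range b)) f
  refine ⟨g, fun i => ?_⟩
  let s : S := ⟨b i, Substructure.subset_closure ⟨i, rfl⟩⟩
  calc g (b i) = f s := (DFunLike.congr_fun hg s).symm
    _ = c i := (heq _ _).1 (hp s)

/-- A finite structure `M` in the expanded signature, with an arbitrary interpretation of the
symbol for equality, has a strong homomorphism to the expansion of a finitely bounded structure `B`
by equality as soon as all of its `n`-tuples are matched by tuples of `B`. Indeed, tuples of
bounded length suffice to see that the symbol is interpreted by a congruence, and that no bound of
`B` embeds into the quotient. -/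
theorem exists_sameAtoms_of_forall_tuple [IsSignature σ] {F : StrClass σ}
    (hFfin : ∀ N ∈ F, Finite N)
    (hF : ∀ A : Bundled.{0} σ.Structure, Finite A →
      (Nonempty (A ↪[σ] B) ↔ ∀ N ∈ F, IsEmpty (N ↪[σ] A)))
    {n : ℕ} (h3 : 3 ≤ n) (hσ : ∀ k, σ.Relations k → 2 * k ≤ n) (hcard : ∀ N ∈ F, Nat.card N ≤ n)
    {M : Type} [Finite M] [(σ.sum eqLang).Structure M]
    (hM : ∀ v : Fin n → M, ∃ w : Fin n → B, SameAtoms (σ.sum eqLang) v w) :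
    ∃ f : M → B, SameAtoms (σ.sum eqLang) (id : M → M) f := by
  have := IsSignature.relational (L := σ)
  -- Families indexed by at most `n` elements are matched in `B` as well.
  have hloc : ∀ {X : Type} [Finite X], Nat.card X ≤ n → ∀ u : X → M,
      ∃ w : X → B, SameAtoms (σ.sum eqLang) u w := by
    intro X _ hX u
    rcases isEmpty_or_nonempty X with hX | hX
    · exact ⟨isEmptyElim, fun k R x =>
        isEmptyElim (x ⟨0, IsSignature.arity_pos (L := σ.sum eqLang) k R⟩)⟩
    · let e : X → Fin n := fun x => Fin.castLE ‹_› (Finite.equivFin X x)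
      have he : Function.Injective e := fun x y hxy => by simpa [e] using hxy
      obtain ⟨w, hw⟩ := hM (u ∘ Function.invFun e)
      refine ⟨w ∘ e, ?_⟩
      have := hw.comp e
      rwa [Function.comp_assoc, Function.invFun_comp he] at this
  let E : M → M → Prop := fun x y => RelMap (eqSymbol σ) ![x, y]
  have hE : ∀ {X : Type} {u : X → M} {w : X → B}, SameAtoms (σ.sum eqLang) u w →
      ∀ i j, E (u i) (u j) ↔ w i = w j := fun {X u w} h i j => by
    have := h 2 (eqSymbol σ) ![i, j]
    have hu : u ∘ ![i, j] = ![u i, u j] := by ext l; fin_cases l <;> rfl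
    rwa [hu] at this
  have hloc3 : ∀ x y z : M, ∃ w : Fin 3 → B, SameAtoms (σ.sum eqLang) ![x, y, z] w :=
    fun x y z => hloc (by simpa using h3) _
  let s : Setoid M :=
    { r := E
      iseqv :=
        { refl := fun x => by
            obtain ⟨w, hw⟩ := hloc3 x x x
            exact (hE hw 0 0).2 rfl
          symm := fun {x y} h => by
            obtain ⟨w, hw⟩ := hloc3 x y y
            exact (hE hw 1 0).2 ((hE hw 0 1).1 h).symm
          trans := fun {x y z} h h' => by
            obtain ⟨w, hw⟩ := hloc3 x y z
            exact (hE hw 0 2).2 (((hE hw 0 1).1 h).trans ((hE hw 1 2).1 h')) } }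
  have hs : ∀ q q' : Quotient s, E q.out q'.out → q = q' := fun q q' h =>
    Quotient.out_equiv_out.1 h
  let _ : σ.Structure (Quotient s) :=
    { funMap := fun g => isEmptyElim g
      RelMap := fun R x => RelMap (L := σ.sum eqLang) (Sum.inl R) (Quotient.out ∘ x) }
  obtain ⟨h⟩ : Nonempty (Quotient s ↪[σ] B) := by
    refine (hF (Bundled.of (Quotient s)) (inferInstanceAs (Finite (Quotient s)))).2
      fun N hN => ⟨fun g => ?_⟩
    have := hFfin N hN
    obtain ⟨w, hw⟩ := hloc (hcard N hN) (Quotient.out ∘ g)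
    -- A bound embedding into the quotient would embed into `B`, hence not into itself.
    refine ((hF N this).1 ⟨?_⟩ N hN).false (Embedding.refl σ N)
    exact
      { toFun := w
        inj' := fun i j hij => g.injective (hs _ _ ((hE hw i j).2 hij))
        map_fun' := fun g => isEmptyElim g
        map_rel' := fun R x => (hw _ (Sum.inl R) x).symm.trans (g.map_rel R x) }
  refine ⟨fun m => h (Quotient.mk s m), ?_⟩
  rintro k (R | R) x
  · refine Iff.trans ?_ (h.map_rel R fun i => Quotient.mk s (x i)).symm
    obtain ⟨w, hw⟩ := hloc (by simpa [two_mul] using hσ k R)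
      (Sum.elim x fun i => (Quotient.mk s (x i)).out)
    have hw' : w ∘ Sum.inl = w ∘ Sum.inr := funext fun i =>
      (hE hw (.inl i) (.inr i)).1 (s.symm (Quotient.mk_out (s := s) (x i)))
    have h₁ := hw k (Sum.inl R) Sum.inl
    have h₂ := hw k (Sum.inl R) Sum.inr
    rw [hw'] at h₁
    exact h₁.trans h₂.symm
  · cases R
    have hx : x = ![x 0, x 1] := by ext i; fin_cases i <;> rfl
    have : E (x 0) (x 1) ↔ h (Quotient.mk s (x 0)) = h (Quotient.mk s (x 1)) :=
      Quotient.eq.symm.trans h.injective.eq_iff.symm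
    conv_lhs => rw [hx]
    exact this

/-- The class of all finite structures with a strong homomorphism to the expansion of `B` by
equality: the finite blow-ups of finite substructures of `B`. -/
def blowUps (σ : FirstOrder.Language.{0, 0}) (B : Type u) [σ.Structure B] :
    StrClass (σ.sum eqLang) :=
  {M | Finite M ∧ ∃ f : M → B, SameAtoms (σ.sum eqLang) (id : M → M) f}

theorem isAmalgamationClass_blowUps [IsSignature σ] (hB : σ.IsUltrahomogeneous B) :
    IsAmalgamationClass (blowUps σ B) where
  nonempty := by
    have := IsSignature.relational (L := σ.sum eqLang)
    exact ⟨⟨Empty, edgeless _ _⟩, inferInstanceAs (Finite Empty), Empty.elim,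
      fun k R x => Empty.elim (x ⟨0, IsSignature.arity_pos k R⟩)⟩
  finite M hM := hM.1
  hereditary := by
    rintro M ⟨_, f, hf⟩ N ⟨_, ⟨e⟩⟩
    exact ⟨Finite.of_injective e e.injective, f ∘ e,
      (SameAtoms.of_embedding e).trans (hf.comp e)⟩
  amalgamation := by
    classical
    have := IsSignature.relational (L := σ)
    have := IsSignature.relational (L := σ.sum eqLang)
    rintro M N P e₁ e₂ ⟨_, -⟩ ⟨_, f₁, hf₁⟩ ⟨_, f₂, hf₂⟩
    -- After applying an automorphism of `B`, the two maps to `B` agree on `M`.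
    have h₁ := (SameAtoms.of_embedding e₁).trans (hf₁.comp e₁)
    have h₂ := (SameAtoms.of_embedding e₂).trans (hf₂.comp e₂)
    obtain ⟨g, hg⟩ := exists_equiv_of_sameAtoms hB (h₁.symm.trans h₂)
    -- The amalgam is the pushout of sets, with the structure pulled back from `B`.
    let Q := N ⊕ {p : P // p ∉ Set.range e₂}
    let f : Q → B := Sum.elim (g ∘ f₁) (fun p => f₂ p)
    let _ := pullback (σ.sum eqLang) f
    let j : P → Q := fun p =>
      if hp : p ∈ Set.range e₂ then .inl (e₁ hp.choose) else .inr ⟨p, hp⟩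
    have hj₁ : ∀ m, j (e₂ m) = .inl (e₁ m) := fun m => by
      have hm : e₂ m ∈ Set.range e₂ := ⟨m, rfl⟩
      simp only [j, dif_pos hm]
      rw [e₂.injective hm.choose_spec]
    have hj₂ : ∀ p (hp : p ∉ Set.range e₂), j p = .inr ⟨p, hp⟩ := fun p hp => dif_neg hp
    have hfj : ∀ p, f (j p) = f₂ p := fun p => by
      by_cases hp : p ∈ Set.range e₂
      · obtain ⟨m, rfl⟩ := hp
        rw [hj₁]; exact hg m
      · rw [hj₂ p hp]; rfl
    have hj : Function.Injective j := fun p q hpq => by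
      by_cases hp : p ∈ Set.range e₂ <;> by_cases hq : q ∈ Set.range e₂
      · obtain ⟨m, rfl⟩ := hp
        obtain ⟨m', rfl⟩ := hq
        rw [hj₁, hj₁] at hpq
        rw [e₁.injective (Sum.inl_injective hpq)]
      · obtain ⟨m, rfl⟩ := hp
        rw [hj₁, hj₂ q hq] at hpq
        cases hpq
      · obtain ⟨m, rfl⟩ := hq
        rw [hj₁, hj₂ p hp] at hpq
        cases hpq
      · rw [hj₂ p hp, hj₂ q hq] at hpq
        exact congrArg Subtype.val (Sum.inr_injective hpq)
    have hgf : SameAtoms (σ.sum eqLang) (id : N → N) (f ∘ Sum.inl) := hf₁.trans <| by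
      rintro k (R | R) x
      · exact (g.map_rel R _).symm
      · cases R; exact g.injective.eq_iff.symm
    have hi : SameAtoms (σ.sum eqLang) (id : N → N) (Sum.inl : N → Q) := hgf
    have hj' : SameAtoms (σ.sum eqLang) (id : P → P) j := hf₂.trans <| by
      have : f₂ = f ∘ j := funext fun p => (hfj p).symm
      rw [this]
      exact fun _ _ _ => Iff.rfl
    exact ⟨Bundled.of Q, hi.toEmbedding Sum.inl_injective, hj'.toEmbedding hj,
      ⟨inferInstanceAs (Finite Q), f, sameAtoms_pullback _ f⟩,
      Embedding.ext fun m => (hj₁ m).symm⟩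

/-- The CSP of a first-order reduct of a binary finitely bounded homogeneous structure `B` is in
ASNP: guess a blow-up of a substructure of `B`, that is, a map to `B` up to automorphisms. By
homogeneity it determines which tuples are mapped to each first-order definable relation. -/
theorem inASNP_csp {τ : FirstOrder.Language.{0, 0}} [IsSignature τ] [IsSignature σ]
    [τ.Structure B] (hbin : IsBinary σ) (hbd : FinitelyBounded σ B)
    (hB : σ.IsUltrahomogeneous B) (hred : IsFirstOrderReduct τ σ B) : InASNP (Csp τ B) := by
  have := IsSignature.relational (L := σ)
  have := IsSignature.relational (L := τ)
  have := IsSignature.relational (L := σ.sum eqLang)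
  have hfinτ : Finite (Σ k, τ.Relations k) := IsSignature.finite
  have hfin : Finite (Σ k, (σ.sum eqLang).Relations k) := IsSignature.finite
  obtain ⟨F, hFf, hFfin, hF⟩ := hbd
  obtain ⟨n₁, hn₁⟩ := (Set.Finite.image (fun N : Bundled σ.Structure => Nat.card N) hFf).bddAbove
  obtain ⟨n₂, hn₂⟩ := (Set.finite_range fun p : Σ k, τ.Relations k => p.1).bddAbove
  -- Enough variables for two binary tuples, for the bounds, and for the tuples of each `τ`-relation.
  let n := 4 + n₁ + n₂
  have hcard : ∀ N ∈ F, Nat.card N ≤ n := fun N hN => by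
    have : Nat.card N ≤ n₁ := hn₁ ⟨N, hN, rfl⟩
    omega
  have hτ : ∀ p : Σ k, τ.Relations k, p.1 ≤ n := fun p => by
    have : p.1 ≤ n₂ := hn₂ ⟨p, rfl⟩
    omega
  -- Definable relations are invariant under automorphisms of `B`.
  have hinv : ∀ (p : Σ k, τ.Relations k) (b c : Fin p.1 → B),
      SameAtoms (σ.sum eqLang) b c → RelMap p.2 b → RelMap p.2 c := fun p b c h hb => by
    obtain ⟨g, hg⟩ := exists_equiv_of_sameAtoms hB h
    obtain ⟨θ, hθ⟩ := Set.empty_definable_iff.1 (hred p.1 p.2)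
    have hθ' : ∀ b : Fin p.1 → B, RelMap p.2 b ↔ θ.Realize b := fun b => Set.ext_iff.1 hθ b
    obtain rfl : g ∘ b = c := funext hg
    rwa [hθ', StrongHomClass.realize_formula g, ← hθ']
  obtain ⟨χ, hqf, heq, hχ⟩ := exists_formula_sameAtoms hfin (fun _ : Fin n → B => True)
  choose ψ hψqf hψeq hψ using fun p : Σ k, τ.Relations k =>
    exists_formula_sameAtoms hfin (fun b : Fin p.1 → B => RelMap p.2 b)
  obtain ⟨φ, hφ, hφr⟩ := exists_isASNPConjunction χ hqf heq ψ (fun p => ⟨hψqf p, hψeq p⟩) hτ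
  have hχM : ∀ (M : Type) [Finite M] [(σ.sum eqLang).Structure M],
      (∀ v : Fin n → M, χ.Realize v) ↔
        ∃ f : M → B, SameAtoms (σ.sum eqLang) (id : M → M) f := fun M _ _ => by
    simp only [hχ, true_and]
    constructor
    · refine exists_sameAtoms_of_forall_tuple hFfin hF (by omega) (fun k R => ?_) hcard
      have := hbin k R
      omega
    · rintro ⟨f, hf⟩ v
      exact ⟨f ∘ v, hf.comp v⟩
  let Φ : SNPSentence τ := ⟨σ.sum eqLang, inferInstance, n, φ, hφ.isQF_eqFree.1, hφ.isQF_eqFree.2⟩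
  refine ⟨Φ, ⟨isBinary_sum_eqLang hbin, hφ, ?_⟩, ?_⟩
  · suffices h : Φ.reducts = blowUps σ B from h ▸ isAmalgamationClass_blowUps hB
    ext M
    refine and_congr_right fun _ => ?_
    rw [← hχM M]
    refine ⟨fun ⟨_, h⟩ => ((hφr M).1 h).1, fun h => ⟨edgeless τ M, ?_⟩⟩
    let _ := edgeless τ M
    exact (hφr M).2 ⟨h, fun _ _ h => h.elim⟩
  · ext A
    refine and_congr_right fun _ => ?_
    constructor
    · rintro ⟨_, h⟩
      obtain ⟨h₁, h₂⟩ := (hφr A).1 h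
      obtain ⟨f, hf⟩ := (hχM A).1 h₁
      refine ⟨⟨f, fun g => isEmptyElim g, fun {k} S a ha => ?_⟩⟩
      obtain ⟨w, hw, haw⟩ := (hψ ⟨k, S⟩ A a).1 (h₂ ⟨k, S⟩ a ha)
      exact hinv ⟨k, S⟩ _ _ (haw.symm.trans (hf.comp a)) hw
    · rintro ⟨f⟩
      let _ := pullback (σ.sum eqLang) f
      have hf : SameAtoms (σ.sum eqLang) (id : A → A) f := sameAtoms_pullback _ f
      exact ⟨pullback (σ.sum eqLang) f, (hφr A).2 ⟨(hχM A).2 ⟨f, hf⟩, fun p a ha =>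
        (hψ p A a).2 ⟨f ∘ a, f.map_rel p.2 a ha, hf.comp a⟩⟩⟩

end

/-! ### Fraïssé limits of amalgamation classes -/

section Fraisse

variable {L : FirstOrder.Language.{0, 0}} {K : StrClass L}

theorem finite_structure [IsSignature L] (m : ℕ) : Finite (L.Structure (Fin m)) := by
  have := IsSignature.relational (L := L)
  have : Finite (Σ k, L.Relations k) := IsSignature.finite
  refine Finite.of_injective (β := ∀ p : Σ k, L.Relations k, (Fin p.1 → Fin m) → Prop)
    (fun A p => A.RelMap p.2) fun A A' h => Structure.ext ?_ ?_
  · funext k g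
    exact isEmptyElim g
  · funext k R
    exact congrFun h ⟨k, R⟩

theorem finite_embedding (M N : Type*) [L.Structure M] [L.Structure N] [Finite M] [Finite N] :
    Finite (M ↪[L] N) :=
  Finite.of_injective _ (DFunLike.coe_injective (F := M ↪[L] N))

/-- The structure with empty domain embeds into every structure. -/
theorem nonempty_embedding_edgeless (N : Type*) [L.Structure N] [IsSignature L] [L.IsRelational] :
    letI := edgeless L Empty
    Nonempty (Empty ↪[L] N) := by
  let _ := edgeless L Empty
  have h : SameAtoms L (id : Empty → Empty) (Empty.elim : Empty → N) :=
    fun k R x => (x ⟨0, IsSignature.arity_pos k R⟩).elim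
  exact ⟨h.toEmbedding fun x => x.elim⟩

theorem IsAmalgamationClass.mem_of_embedding (hK : IsAmalgamationClass K)
    {M N : Bundled.{0} L.Structure} (hN : N ∈ K) (e : M ↪[L] N) : M ∈ K := by
  have := hK.finite N hN
  have : Finite M := Finite.of_injective e e.injective
  exact hK.hereditary N hN ⟨FG.of_finite, ⟨e⟩⟩

theorem IsAmalgamationClass.edgeless_mem [IsSignature L] [L.IsRelational]
    (hK : IsAmalgamationClass K) :
    Bundled.mk Empty (edgeless L Empty) ∈ K := by
  obtain ⟨M, hM⟩ := hK.nonempty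
  obtain ⟨e⟩ := nonempty_embedding_edgeless (L := L) M
  exact hK.mem_of_embedding hM e

/-- Finitely many extension problems over a member of an amalgamation class are solved
simultaneously in one extension of it. -/
theorem IsAmalgamationClass.exists_solution (hK : IsAmalgamationClass K)
    (M : K) {ι : Type} [Finite ι] (A C : ι → K)
    (e : ∀ i, (A i).1 ↪[L] (C i).1) (f : ∀ i, (A i).1 ↪[L] M.1) :
    ∃ (M' : K) (g : M.1 ↪[L] M'.1), ∀ i, ∃ h : (C i).1 ↪[L] M'.1, h.comp (e i) = g.comp (f i) := by
  classical
  have := Fintype.ofFinite ι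
  suffices h : ∀ s : Finset ι, ∃ (M' : K) (g : M.1 ↪[L] M'.1),
      ∀ i ∈ s, ∃ h : (C i).1 ↪[L] M'.1, h.comp (e i) = g.comp (f i) by
    simpa using h Finset.univ
  intro s
  induction s using Finset.induction_on with
  | empty => exact ⟨M, Embedding.refl L _, by simp⟩
  | insert i s _ ih =>
    obtain ⟨M', g, hg⟩ := ih
    obtain ⟨Q, h, g', hQ, hh⟩ := hK.amalgamation _ _ _ (e i) (g.comp (f i))
      (A i).2 (C i).2 M'.2
    refine ⟨⟨Q, hQ⟩, g'.comp g, fun j hj => ?_⟩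
    rcases Finset.mem_insert.1 hj with rfl | hj
    · exact ⟨h, by rw [hh, Embedding.comp_assoc]⟩
    · obtain ⟨h', hh'⟩ := hg j hj
      exact ⟨g'.comp h', by rw [Embedding.comp_assoc, hh', Embedding.comp_assoc]⟩

/-- The members of a class with domain `{0,…,m-1}`. -/
def onFin (K : StrClass L) (m : ℕ) : Type :=
  {A : L.Structure (Fin m) // Bundled.mk (Fin m) A ∈ K}

/-- A member of a class with domain `{0,…,m-1}` as a member of the class. -/
def onFin.toMem {m : ℕ} (A : onFin K m) : K := ⟨Bundled.mk (Fin m) A.1, A.2⟩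

instance {m : ℕ} (A : onFin K m) : Finite A.toMem.1 := inferInstanceAs (Finite (Fin m))

theorem IsAmalgamationClass.exists_onFin (hK : IsAmalgamationClass K)
    (M : Bundled.{0} L.Structure) (hM : M ∈ K) :
    ∃ (m : ℕ) (A : onFin K m), Nonempty (M ≃[L] A.toMem.1) := by
  have := hK.finite M hM
  let e := Finite.equivFin M
  let A : L.Structure (Fin (Nat.card M)) := e.inducedStructure
  let g : M ≃[L] Bundled.mk (Fin (Nat.card M)) A := e.inducedStructureEquiv
  exact ⟨_, ⟨A, hK.mem_of_embedding (M := Bundled.mk _ A) hM g.symm.toEmbedding⟩, ⟨g⟩⟩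

/-- One step of the construction of the limit: an extension that solves all extension problems of
size at most `i`. -/
theorem IsAmalgamationClass.exists_step [IsSignature L] (hK : IsAmalgamationClass K) (M : K)
    (i : ℕ) :
    ∃ (M' : K) (g : M.1 ↪[L] M'.1), ∀ a ≤ i, ∀ c ≤ i, ∀ (A : onFin K a) (C : onFin K c)
      (e : A.toMem.1 ↪[L] C.toMem.1) (f : A.toMem.1 ↪[L] M.1),
      ∃ h : C.toMem.1 ↪[L] M'.1, h.comp e = g.comp f := by
  have := hK.finite M.1 M.2
  have : ∀ m, Finite (onFin K m) := fun m => by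
    have := finite_structure (L := L) m
    exact Subtype.finite
  have : ∀ {a c} (A : onFin K a) (C : onFin K c), Finite (A.toMem.1 ↪[L] C.toMem.1) :=
    fun A C => finite_embedding _ _
  have : ∀ {a} (A : onFin K a), Finite (A.toMem.1 ↪[L] M.1) := fun A => finite_embedding _ _
  let ι := Σ (p : Fin (i + 1) × Fin (i + 1)) (q : onFin K p.1 × onFin K p.2),
    (q.1.toMem.1 ↪[L] q.2.toMem.1) × (q.1.toMem.1 ↪[L] M.1)
  obtain ⟨M', g, h⟩ := hK.exists_solution M (ι := ι) (fun t => t.2.1.1.toMem)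
    (fun t => t.2.1.2.toMem) (fun t => t.2.2.1) (fun t => t.2.2.2)
  exact ⟨M', g, fun a ha c hc A C e f => h
    ⟨(⟨a, Nat.lt_succ_of_le ha⟩, ⟨c, Nat.lt_succ_of_le hc⟩), (A, C), (e, f)⟩⟩

/-- A countable structure in which all extension problems over its age are solvable is
homogeneous. -/
theorem isUltrahomogeneous_of_extension [L.IsRelational] {B : Type} [L.Structure B] [Countable B]
    (hB : ∀ (A C : Bundled.{0} L.Structure) (e : A ↪[L] C) (f : A ↪[L] B), Finite A → Finite C →
      Nonempty (C ↪[L] B) → ∃ h : C ↪[L] B, h.comp e = f) : L.IsUltrahomogeneous B := by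
  rw [isUltrahomogeneous_iff_IsExtensionPair cg_of_countable,
    isExtensionPair_iff_exists_embedding_closure_singleton_sup]
  intro S hS f m
  obtain ⟨h, hh⟩ := hB (Bundled.of S)
    (Bundled.of (Substructure.closure L {m} ⊔ S : L.Substructure B))
    (Substructure.inclusion le_sup_right) f hS.finite
    ((Substructure.fg_closure_singleton m).sup hS).finite ⟨Substructure.subtype _⟩
  exact ⟨h, hh.symm⟩

/-- Every amalgamation class over a finite relational signature is the class of finite structures
that embed into some homogeneous structure. -/
theorem IsAmalgamationClass.exists_isUltrahomogeneous [IsSignature L]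
    (hK : IsAmalgamationClass K) :
    ∃ (B : Type) (_ : L.Structure B), L.IsUltrahomogeneous B ∧
      ∀ A : Bundled.{0} L.Structure, A ∈ K ↔ Finite A ∧ Nonempty (A ↪[L] B) := by
  have := IsSignature.relational (L := L)
  choose next g hg using hK.exists_step
  let G : ℕ → K := Nat.rec ⟨_, hK.edgeless_mem⟩ fun n M => next M n
  let s : ∀ n, (G n).1 ↪[L] (G (n + 1)).1 := fun n => g (G n) n
  let G' : ℕ → Type := fun n => (G n).1
  let s' : ∀ n, G' n ↪[L] G' (n + 1) := s
  have hGfin : ∀ n, Finite (G' n) := fun n => hK.finite _ (G n).2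
  let f : ∀ i j, i ≤ j → G' i ↪[L] G' j := DirectedSystem.natLERec s'
  let B := Language.DirectLimit G' f
  let o : ∀ i, G' i ↪[L] B := Language.DirectLimit.of L ℕ G' f
  have hos : ∀ i x, o (i + 1) (s' i x) = o i x := fun i x => by
    have : f i (i + 1) i.le_succ x = s' i x := by
      rw [DirectedSystem.coe_natLERec]
      exact Nat.leRecOn_succ' _
    rw [← this]
    exact Language.DirectLimit.of_f
  have hcount : Countable B := by
    have hG : ∀ i, Countable (G' i) := fun i => @Finite.to_countable _ (hGfin i)
    have : Countable (Σ i : ℕ, G' i) := inferInstance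
    exact Function.Surjective.countable (f := fun p : Σ i, G' i => o p.1 p.2) fun z => by
      obtain ⟨i, x, h⟩ := Language.DirectLimit.exists_of z
      exact ⟨⟨i, x⟩, h⟩
  -- Embeddings of finite structures factor through all late stages.
  have hfactor : ∀ {A : Type} [L.Structure A] [Finite A] (e : A ↪[L] B) (k : ℕ),
      ∃ j ≥ k, ∃ e' : A ↪[L] G' j, (o j).comp e' = e := by
    intro A _ _ e k
    obtain ⟨i, y, hy⟩ := Language.DirectLimit.exists_quotient_mk'_sigma_mk'_eq G' f e
    let j := max i k
    let y' : A → G' j := fun a => f i j (le_max_left _ _) (y a)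
    have hy' : ∀ a, o j (y' a) = e a := fun a => by
      rw [hy]
      exact Language.DirectLimit.of_f
    have h : SameAtoms L (id : A → A) y' := fun m R x => by
      have h₁ := e.map_rel R x
      have h₂ := (o j).map_rel R (y' ∘ x)
      rw [show o j ∘ (y' ∘ x) = e ∘ x from funext fun _ => hy' _] at h₂
      exact h₁.symm.trans h₂
    refine ⟨j, le_max_right _ _, h.toEmbedding fun a b hab => e.injective ?_,
      Embedding.ext hy'⟩
    rw [← hy', ← hy', hab]
  have hage : ∀ A : Bundled.{0} L.Structure, Finite A → Nonempty (A ↪[L] B) → A ∈ K := by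
    rintro A _ ⟨e⟩
    obtain ⟨j, -, e', -⟩ := hfactor e 0
    exact hK.mem_of_embedding (G j).2 e'
  have hext : ∀ (A C : Bundled.{0} L.Structure) (e : A ↪[L] C) (f : A ↪[L] B), C ∈ K →
      ∃ h : C ↪[L] B, h.comp e = f := by
    intro A C e f hC
    obtain ⟨a, A', ⟨gA⟩⟩ := hK.exists_onFin A (hK.mem_of_embedding hC e)
    obtain ⟨c, C', ⟨gC⟩⟩ := hK.exists_onFin C hC
    obtain ⟨j, hj, f', hf'⟩ := hfactor (f.comp gA.symm.toEmbedding) (max a c)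
    obtain ⟨h, hh⟩ := hg (G j) j a ((le_max_left _ _).trans hj) c ((le_max_right _ _).trans hj)
      A' C' ((gC.toEmbedding.comp e).comp gA.symm.toEmbedding) f'
    refine ⟨((o (j + 1)).comp h).comp gC.toEmbedding, Embedding.ext fun x => ?_⟩
    have hx : gA.symm (gA x) = x := gA.symm_apply_apply x
    have h₁ : h (gC (e (gA.symm (gA x)))) = g (G j) j (f' (gA x)) := DFunLike.congr_fun hh (gA x)
    have h₂ : o j (f' (gA x)) = f (gA.symm (gA x)) := DFunLike.congr_fun hf' (gA x)
    rw [hx] at h₁ h₂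
    change o (j + 1) (h (gC (e x))) = f x
    rw [h₁, ← h₂]
    exact hos j _
  refine ⟨B, inferInstance, isUltrahomogeneous_of_extension fun A C e f _ _ hC =>
    hext A C e f (hage C ‹_› hC), fun A => ⟨fun hA => ⟨hK.finite A hA, ?_⟩, fun h => hage A h.1 h.2⟩⟩
  obtain ⟨e⟩ := nonempty_embedding_edgeless (L := L) A
  obtain ⟨f⟩ := nonempty_embedding_edgeless (L := L) B
  obtain ⟨h, -⟩ := hext (Bundled.mk Empty (edgeless L Empty)) A e f hA
  exact ⟨h⟩

end Fraisse

/-! ### From ASNP to reducts of binary finitely bounded homogeneous structures -/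

/-- A class of finite structures defined by a universal sentence with `n` variables and without
equality is described by finitely many bounds, namely those of size at most `n`. -/
theorem finitelyBounded_of_age {L : FirstOrder.Language.{0, 0}} [IsSignature L] {B : Type}
    [L.Structure B] {n : ℕ} {χ : L.Formula (Fin n)} (hqf : χ.IsQF) (heq : EqFree χ)
    (hB : ∀ A : Bundled.{0} L.Structure, Finite A →
      (Nonempty (A ↪[L] B) ↔ ∀ v : Fin n → A, χ.Realize v)) :
    FinitelyBounded L B := by
  have := IsSignature.relational (L := L)
  have := finite_structure (L := L)
  let toBundled : (Σ m : Fin (n + 1), L.Structure (Fin m)) → Bundled.{0} L.Structure :=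
    fun p => ⟨Fin p.1, p.2⟩
  refine ⟨Set.range toBundled ∩ {N | ¬ Nonempty (N ↪[L] B)},
    (Set.finite_range _).inter_of_left _, ?_, fun A hA => ⟨?_, fun h => ?_⟩⟩
  · rintro _ ⟨⟨p, rfl⟩, -⟩
    exact inferInstanceAs (Finite (Fin p.1))
  · rintro ⟨e⟩ N ⟨-, hN⟩
    exact ⟨fun g => hN ⟨e.comp g⟩⟩
  · rw [hB A hA]
    -- The image of a violating tuple is a bound that embeds.
    by_contra! hv
    obtain ⟨v, hv⟩ := hv
    let e := Finite.equivFin (Set.range v)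
    have hm : Nat.card (Set.range v) < n + 1 := by
      have := Finite.card_range_le v
      rw [Nat.card_fin] at this
      omega
    let f : Fin (Nat.card (Set.range v)) → A := fun i => e.symm i
    have hf : Function.Injective f := Subtype.val_injective.comp e.symm.injective
    let _ := pullback L f
    let N : Bundled.{0} L.Structure := Bundled.of (Fin (Nat.card (Set.range v)))
    have hNA : SameAtoms L (id : N → N) f := sameAtoms_pullback L f
    refine (h N ⟨⟨⟨⟨_, hm⟩, pullback L f⟩, rfl⟩, fun hN => hv ?_⟩).false (hNA.toEmbedding hf)
    let w : Fin n → N := fun i => e ⟨v i, i, rfl⟩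
    have hw : f ∘ w = v := funext fun i => congrArg Subtype.val (e.symm_apply_apply _)
    have h₁ := (hB N (inferInstanceAs (Finite (Fin _)))).1 hN w
    have h₂ : SameAtoms L w v := hw ▸ hNA.comp w
    exact (h₂.realize_formula hqf heq).1 h₁

/-- The models of an ASNP sentence form the CSP of a reduct of the Fraïssé limit `B` of its class of
reducts: each `τ`-relation of the template is the largest one permitted by the sentence. Formulas
without equality are reflected by strong homomorphisms, hence the `ρ`-structure of `B` can be
pulled back along homomorphisms that are not injective. -/
theorem IsBinaryReductCsp.of_inASNP {τ : FirstOrder.Language.{0, 0}} [IsSignature τ]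
    {K : StrClass τ} (h : InASNP K) : IsBinaryReductCsp.{0} K := by
  obtain ⟨Φ, ⟨hbin, hconj, hamalg⟩, rfl⟩ := h
  have := Φ.isSignature
  have := IsSignature.relational (L := τ)
  have := IsSignature.relational (L := Φ.ρ)
  obtain ⟨χ, ψ, hqf, heq, hψ, hΦ⟩ := hconj.exists_normalForm
  have hred : ∀ M : Bundled.{0} Φ.ρ.Structure,
      M ∈ Φ.reducts ↔ Finite M ∧ ∀ v : Fin Φ.n → M, χ.Realize v := fun M => by
    refine and_congr_right fun _ => ⟨fun ⟨_, h⟩ => ((hΦ M).1 h).1, fun h => ⟨edgeless τ M, ?_⟩⟩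
    let _ := edgeless τ M
    exact (hΦ M).2 ⟨h, fun _ _ h => h.elim⟩
  obtain ⟨B, _, hhom, hage⟩ := hamalg.exists_isUltrahomogeneous
  have hB : ∀ A : Bundled.{0} Φ.ρ.Structure, Finite A →
      (Nonempty (A ↪[Φ.ρ] B) ↔ ∀ v : Fin Φ.n → A, χ.Realize v) := fun A hA => by
    have := (hage A).symm.trans (hred A)
    simpa [hA] using this
  let _ : τ.Structure B :=
    { funMap := fun g => isEmptyElim g
      RelMap := fun {k} S b => (ψ ⟨k, S⟩).Realize b }
  refine ⟨Φ.ρ, B, inferInstance, inferInstance, Φ.isSignature, hbin,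
    finitelyBounded_of_age hqf heq hB, hhom,
    fun k S => Set.empty_definable_iff.2 ⟨ψ ⟨k, S⟩, rfl⟩, ?_⟩
  ext A
  refine and_congr_right fun hA => ⟨?_, ?_⟩
  · rintro ⟨f⟩
    let _ := pullback Φ.ρ f
    have hf : SameAtoms Φ.ρ (id : A → A) f := sameAtoms_pullback _ f
    refine ⟨pullback Φ.ρ f, (hΦ A).2 ⟨fun v => ?_, fun p a ha => ?_⟩⟩
    · -- The image of `f` is a finite substructure of `B`, hence satisfies `χ`.
      let S := Substructure.closure Φ.ρ (Set.range f)
      have hS : Finite S := (Substructure.fg_closure (Set.finite_range f)).finite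
      let w : Fin Φ.n → S := fun i => ⟨f (v i), Substructure.subset_closure ⟨v i, rfl⟩⟩
      have hw : SameAtoms Φ.ρ w (f ∘ v) := fun _ _ _ => Iff.rfl
      exact (((hf.comp v).trans hw.symm).realize_formula hqf heq).2
        ((hB (Bundled.of S) hS).1 ⟨Substructure.subtype S⟩ w)
    · exact ((hf.comp a).realize_formula (hψ p).1 (hψ p).2).2 (f.map_rel p.2 a ha)
  · rintro ⟨_, h⟩
    obtain ⟨h₁, h₂⟩ := (hΦ A).1 h
    obtain ⟨e⟩ := (hB (Bundled.of A) hA).2 h₁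
    refine ⟨⟨e, fun g => isEmptyElim g, fun {k} S a ha => ?_⟩⟩
    exact (((SameAtoms.of_embedding e).comp a).realize_formula (hψ ⟨k, S⟩).1 (hψ ⟨k, S⟩).2).1
      (h₂ ⟨k, S⟩ a ha)

/-- The template can be moved to any universe. -/
theorem IsBinaryReductCsp.ulift {τ : FirstOrder.Language.{0, 0}} {K : StrClass τ}
    (h : IsBinaryReductCsp.{0} K) : IsBinaryReductCsp.{u} K := by
  obtain ⟨σ, B, _, _, hσ, hbin, ⟨F, hFf, hFfin, hF⟩, hhom, hred, rfl⟩ := h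
  have := IsSignature.relational (L := σ)
  let e : B ≃ ULift.{u} B := Equiv.ulift.symm
  let _ : σ.Structure (ULift.{u} B) := e.inducedStructure
  let _ : τ.Structure (ULift.{u} B) := e.inducedStructure
  let g : B ≃[σ] ULift.{u} B := e.inducedStructureEquiv
  let g' : B ≃[τ] ULift.{u} B := e.inducedStructureEquiv
  refine ⟨σ, ULift.{u} B, inferInstance, inferInstance, hσ, hbin,
    ⟨F, hFf, hFfin, fun A hA => Iff.trans ?_ (hF A hA)⟩, ?_, fun k S => ?_, ?_⟩
  · exact ⟨fun ⟨f⟩ => ⟨g.symm.toEmbedding.comp f⟩, fun ⟨f⟩ => ⟨g.toEmbedding.comp f⟩⟩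
  · intro S hS f
    let S₀ := S.comap g.toHom
    let k : S₀ ↪[σ] S :=
      { toFun := fun s => ⟨g s, s.2⟩
        inj' := fun s t hst => Subtype.ext (g.injective (congrArg Subtype.val hst))
        map_fun' := fun g => isEmptyElim g
        map_rel' := fun R x => g.map_rel R fun i => (x i : B) }
    have := hS.finite
    have : Finite S₀ := Finite.of_injective k k.injective
    obtain ⟨h, hh⟩ := hhom S₀ .of_finite ((g.symm.toEmbedding.comp f).comp k)
    refine ⟨(g.comp h).comp g.symm, Embedding.ext fun s => ?_⟩
    let s₀ : S₀ := ⟨g.symm s, by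
      change g (g.symm s) ∈ S
      rw [g.apply_symm_apply]
      exact s.2⟩
    have hs : k s₀ = s := Subtype.ext (g.apply_symm_apply s)
    have h₁ : g.symm (f (k s₀)) = h (g.symm s) := DFunLike.congr_fun hh s₀
    rw [hs] at h₁
    calc f s = g (g.symm (f s)) := (g.apply_symm_apply _).symm
      _ = g (h (g.symm s)) := by rw [h₁]
  · obtain ⟨θ, hθ⟩ := Set.empty_definable_iff.1 (hred k S)
    have hθ' : ∀ b : Fin k → B, RelMap S b ↔ θ.Realize b := fun b => Set.ext_iff.1 hθ b
    refine Set.empty_definable_iff.2 ⟨θ, Set.ext fun b => ?_⟩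
    have h₁ : RelMap S b ↔ RelMap S (g.symm ∘ b) := (g'.symm.map_rel S b).symm
    have h₂ : θ.Realize (g.symm ∘ b) ↔ θ.Realize b := StrongHomClass.realize_formula g.symm θ
    exact h₁.trans ((hθ' _).trans h₂)
  · ext A
    exact and_congr_right fun _ =>
      ⟨fun ⟨f⟩ => ⟨g'.symm.toHom.comp f⟩, fun ⟨f⟩ => ⟨g'.toHom.comp f⟩⟩

end ASNP

/-- The problems in ASNP are exactly the CSPs of first-order reducts of binary finitely bounded
homogeneous structures, and ASNP has a complexity dichotomy if and only if these CSPs do. -/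
theorem mainTheorem1 :
    (∀ (τ : FirstOrder.Language.{0, 0}) [ASNP.IsSignature τ] (K : ASNP.StrClass τ),
      ASNP.InASNP K ↔ ASNP.IsBinaryReductCsp.{u} K) ∧
    (ASNP.ASNPDichotomy ↔ ASNP.BinaryInfiniteDomainDichotomy.{u}) := by
  have main : ∀ (τ : FirstOrder.Language.{0, 0}) [ASNP.IsSignature τ] (K : ASNP.StrClass τ),
      ASNP.InASNP K ↔ ASNP.IsBinaryReductCsp.{u} K := fun τ _ K => by
    refine ⟨fun h => (ASNP.IsBinaryReductCsp.of_inASNP h).ulift, ?_⟩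
    rintro ⟨σ, B, _, _, _, hbin, hbd, hhom, hred, rfl⟩
    exact ASNP.inASNP_csp hbin hbd hhom hred
  refine ⟨main, fun h τ _ σ _ B _ _ hbin hbd hhom hred => ?_, fun h τ _ K hK => ?_⟩
  · exact h τ _ (ASNP.inASNP_csp hbin hbd hhom hred)
  · obtain ⟨σ, B, _, _, _, hbin, hbd, hhom, hred, rfl⟩ := (main τ K).1 hK
    exact h τ σ B hbin hbd hhom hred
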